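/- Let $0<b<a$, let $c=\sqrt{a^2-b^2}$, and let $h>0$ be determined by $\sinh(h/2)=c/b$ (equivalently $\cosh(h/2)=a/b$). Put $$\hat\mu_1(s)=\frac{a}{b^3}-\frac{ab}{(a^2\operatorname{sech}^2 s+b^2\tanh^2 s)^2},\qquad \hat L_1(s)=2b\sum_{j\in\mathbb Z}\hat\mu_1(s+jh),$$ and regard $\hat\mu_1$ also as a meromorphic function on $\mathbb C$, with its removable singularities at $\frac{\pi i}{2}+\pi i\mathbb Z$ removed. Let $s_\pm=\pm\frac h2+\frac{\pi i}2$. There are $\beta_2,\beta_1\in\mathbb C$ with $\beta_2\neq0$ such that $$\hat\mu_1(s_\pm+\sigma)=\frac{\beta_2}{\sigma^2}\pm\frac{\beta_1}{\sigma}+O(1)\qquad(\sigma\to0),$$ and, for this $\beta_2$, the following hold. Let $\mathcal S=\frac h2+\frac{\pi i}2+h\mathbb Z+\pi i\mathbb Z$. 1. The series defining $\hat L_1$ converges at every point of $\mathbb R$ and, more generally, of $\mathbb C\setminus\mathcal S$; its sum is analytic on $\mathbb C\setminus\mathcal S$ and extends $\hat L_1:\mathbb R\to\mathbb R$, which is real-analytic.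 2. This extension is an even elliptic function of order two whose set of periods is $h\mathbb Z+\pi i\mathbb Z$. 3. Its set of poles is $\mathcal S$, every pole is double, and for every $z\in\mathcal S$ $$\hat L_1(z+\sigma)=4b\beta_2\sigma^{-2}+O(1)\qquad(\sigma\to0).$$ 4. $\hat L_1:\mathbb R\to\mathbb R$ is not constant. Its only real critical points are the points of $h\mathbb Z/2$, and all of them are nondegenerate ($\hat L_1''\neq0$ there). -/

import Mathlib

open Filter Topology Asymptotics

noncomputable section

/-- `f` is an elliptic function for the period lattice of `Λ`: it is meromorphic on `ℂ`,
and every lattice vector is a period. -/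
def IsElliptic (Λ : PeriodPair) (f : ℂ → ℂ) : Prop :=
  Meromorphic f ∧ ∀ ω ∈ Λ.lattice, Function.Periodic f ω

/-- The set of poles of a meromorphic function. -/
def poleSet (f : ℂ → ℂ) : Set ℂ := {z | meromorphicOrderAt f z < 0}

/-- The order of an elliptic function: the number of its poles, counted with multiplicity, in the
half-open cell `{x ω₁ + y ω₂ : 0 ≤ x < 1, 0 ≤ y < 1}`.  At a point which is not a pole the
truncation `Int.toNat` gives the summand `0`. -/
def ellipticOrder (Λ : PeriodPair) (f : ℂ → ℂ) : ℕ :=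
  ∑ᶠ z ∈ ZSpan.fundamentalDomain Λ.basis, (-(meromorphicOrderAt f z).untop₀).toNat

/-- The semi-focal distance `c` of the ellipse with semi-lengths `a` and `b`. -/
def semiFocal (a b : ℝ) : ℝ := √(a ^ 2 - b ^ 2)

/-- The characteristic exponent `h`, determined by `sinh (h / 2) = c / b`. -/
def charExponent (a b : ℝ) : ℝ := 2 * Real.arsinh (semiFocal a b / b)

theorem sinh_charExponent (a b : ℝ) : Real.sinh (charExponent a b / 2) = semiFocal a b / b := by
  simp [charExponent]

theorem cosh_charExponent {a b : ℝ} (hb : 0 < b) (hab : b < a) :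
    Real.cosh (charExponent a b / 2) = a / b := by
  have h1 : 0 ≤ a ^ 2 - b ^ 2 := by nlinarith
  have h2 : charExponent a b / 2 = Real.arsinh (semiFocal a b / b) := by
    simp [charExponent]
  have h3 : 1 + (semiFocal a b / b) ^ 2 = (a / b) ^ 2 := by
    rw [div_pow, semiFocal, Real.sq_sqrt h1]
    field_simp
    ring
  rw [h2, Real.cosh_arsinh, h3, Real.sqrt_sq (div_nonneg (hb.trans hab).le hb.le)]

theorem charExponent_pos {a b : ℝ} (hb : 0 < b) (hab : b < a) : 0 < charExponent a b := by
  have h1 : 0 < a ^ 2 - b ^ 2 := by nlinarith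
  have h2 : 0 < semiFocal a b / b := div_pos (Real.sqrt_pos.2 h1) hb
  have h3 : 0 < Real.arsinh (semiFocal a b / b) := Real.arsinh_pos_iff.2 h2
  unfold charExponent
  linarith

/-- The pair of periods `h` and `π i`. -/
def homoclinicPeriods {a b : ℝ} (hb : 0 < b) (hab : b < a) : PeriodPair where
  ω₁ := (charExponent a b : ℂ)
  ω₂ := (Real.pi : ℂ) * Complex.I
  indep := by
    rw [LinearIndependent.pair_iff]
    intro s t hst
    have hre := congrArg Complex.re hst
    have him := congrArg Complex.im hst
    have h0 := (charExponent_pos hb hab).ne'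
    have hpi := Real.pi_ne_zero
    simp [h0, hpi] at hre him
    exact ⟨hre, him⟩

/-- The function `μ̂₁(s) = a / b³ - a b / (a² sech² s + b² tanh² s)²` on the real line. -/
def muHat (a b s : ℝ) : ℝ :=
  a / b ^ 3 - a * b / (a ^ 2 * (Real.cosh s)⁻¹ ^ 2 + b ^ 2 * Real.tanh s ^ 2) ^ 2

/-- The same formula on the complex plane.  At the points `π i / 2 + π i ℤ`, where `sech` and
`tanh` have poles, the conventions `x / 0 = 0` and `0⁻¹ = 0` give the value `a / b³`, which is the
limit of the function there, so this is the meromorphic extension of `muHat`. -/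
def muHatC (a b : ℝ) (s : ℂ) : ℂ :=
  (a : ℂ) / (b : ℂ) ^ 3 - (a : ℂ) * (b : ℂ) /
    ((a : ℂ) ^ 2 * (Complex.cosh s)⁻¹ ^ 2 + (b : ℂ) ^ 2 * Complex.tanh s ^ 2) ^ 2

/-- The homoclinic Melnikov potential `L̂₁(s) = 2 b ∑_{j ∈ ℤ} μ̂₁(s + j h)` on the real line. -/
def melnikovPotential (a b s : ℝ) : ℝ :=
  2 * b * ∑' j : ℤ, muHat a b (s + j * charExponent a b)

/-- The same series on the complex plane. -/
def melnikovPotentialC (a b : ℝ) (s : ℂ) : ℂ :=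
  2 * (b : ℂ) * ∑' j : ℤ, muHatC a b (s + (j : ℂ) * (charExponent a b : ℂ))

/-- The pole `h / 2 + π i / 2` (called `s₊` for `μ̂₁` and `s⋆` for `L̂₁`). -/
def sPlus (a b : ℝ) : ℂ := (charExponent a b : ℂ) / 2 + (Real.pi : ℂ) * Complex.I / 2

/-- The pole `s₋ = -h / 2 + π i / 2` of `μ̂₁`. -/
def sMinus (a b : ℝ) : ℂ := -(charExponent a b : ℂ) / 2 + (Real.pi : ℂ) * Complex.I / 2

/-- The set `h / 2 + π i / 2 + h ℤ + π i ℤ`. -/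
def melnikovPoles (a b : ℝ) : Set ℂ :=
  {z | ∃ m n : ℤ, z = sPlus a b + (m : ℂ) * (charExponent a b : ℂ) +
    (n : ℂ) * ((Real.pi : ℂ) * Complex.I)}

/-- `β₂` and `β₁` are the Laurent coefficients of `μ̂₁` at its poles `s₊` and `s₋`:
`μ̂₁(s± + σ) = β₂ / σ² ± β₁ / σ + O(1)` as `σ → 0`. -/
def AreLaurentCoeffs (a b : ℝ) (β₂ β₁ : ℂ) : Prop :=
  ((fun σ : ℂ => muHatC a b (sPlus a b + σ) - (β₂ / σ ^ 2 + β₁ / σ))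
    =O[𝓝[≠] 0] fun _ => (1 : ℂ)) ∧
  ((fun σ : ℂ => muHatC a b (sMinus a b + σ) - (β₂ / σ ^ 2 - β₁ / σ))
    =O[𝓝[≠] 0] fun _ => (1 : ℂ))

end

/-! The integrand equals `a / b ^ 3 * (1 - cosh s ^ 4 / muDen ^ 2)` with `muDen = cosh (s + h/2) *
cosh (s - h/2)`, so its poles are double and lie at `s₊` and `s₋` modulo `π i`. It decays
quadratically along the real direction, so the series converges locally uniformly once finitely many
terms are set aside.

At `s₊` only the translates `j = 0` and `j = -1` are singular, the second seeing `s₋`. Evenness and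
`π i`-periodicity exchange `s₋ + σ` with `s₊ - σ`, so the two residues cancel and the double-pole
coefficients add. By Liouville the sum is a constant plus `4 b β₂ ℘(z - s₊)` for the lattice spanned
by `h` and `π i` (`exists_melnikovPotentialC_eq_weierstrassP`).

The critical points are then governed by `℘'`, which vanishes exactly at the half periods, and
simply. Both facts come from differential equations: uniqueness for `℘'' = 6 ℘² - g₂/2` shows that
`(℘, ℘')` separates points of `ℂ / Λ`, which identifies the three roots of the Weierstrass cubic,
and `℘''' = 12 ℘ ℘'` excludes multiple zeros. -/

namespace PeriodPair

/-! ### Zeros of `℘'` from the Weierstrass differential equations. -/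

variable (Λ : PeriodPair)

theorem countable_lattice : (Λ.lattice : Set ℂ).Countable := by
  have : Countable Λ.lattice := Λ.latticeEquivProd.toEquiv.countable_iff.2 inferInstance
  exact Set.countable_coe_iff.1 this

theorem isPreconnected_compl_of_countable {s : Set ℂ} (hs : s.Countable) :
    IsPreconnected sᶜ :=
  (hs.isPathConnected_compl_of_one_lt_rank
    (by rw [Complex.rank_real_complex]; norm_num)).isConnected.isPreconnected

theorem tendsto_weierstrassP_cobounded :
    Tendsto ℘[Λ] (𝓝[≠] 0) (Bornology.cobounded ℂ) :=
  tendsto_cobounded_of_meromorphicOrderAt_neg (by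
    rw [Λ.order_weierstrassP 0 (zero_mem _)]; decide)

/-- Differentiating the cubic relation gives this identity multiplied by `℘'`. The factor cancels
because analytic functions on the connected complement of the lattice have no zero divisors, and
`℘'` has a triple pole at `0`. -/
theorem deriv_derivWeierstrassP {z : ℂ} (hz : z ∉ Λ.lattice) :
    deriv ℘'[Λ] z = 6 * ℘[Λ] z ^ 2 - Λ.g₂ / 2 := by
  have hopen : IsOpen (Λ.lattice : Set ℂ)ᶜ := Λ.isClosed_lattice.isOpen_compl
  have hP := Λ.analyticOnNhd_weierstrassP
  have hP' := Λ.analyticOnNhd_derivWeierstrassP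
  have hder : ∀ w ∉ Λ.lattice, HasDerivAt ℘[Λ] (℘'[Λ] w) w := fun w hw => by
    rw [← Λ.deriv_weierstrassP]
    exact (hP w hw).differentiableAt.hasDerivAt
  have hprod : ∀ w ∈ (Λ.lattice : Set ℂ)ᶜ,
      ℘'[Λ] w * (deriv ℘'[Λ] w - (6 * ℘[Λ] w ^ 2 - Λ.g₂ / 2)) = 0 := fun w hw => by
    have h1 : HasDerivAt (fun u => ℘'[Λ] u ^ 2) (2 * ℘'[Λ] w * deriv ℘'[Λ] w) w := by
      simpa using! (hP' w hw).differentiableAt.hasDerivAt.pow 2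
    have h2 : HasDerivAt (fun u => 4 * ℘[Λ] u ^ 3 - Λ.g₂ * ℘[Λ] u - Λ.g₃)
        (4 * (3 * ℘[Λ] w ^ 2 * ℘'[Λ] w) - Λ.g₂ * ℘'[Λ] w) w := by
      simpa using! ((((hder w hw).pow 3).const_mul 4).sub ((hder w hw).const_mul Λ.g₂)).sub_const
        Λ.g₃
    have h3 : (fun u => ℘'[Λ] u ^ 2) =ᶠ[𝓝 w] fun u => 4 * ℘[Λ] u ^ 3 - Λ.g₂ * ℘[Λ] u - Λ.g₃ := by
      filter_upwards [hopen.mem_nhds hw] with u hu using Λ.derivWeierstrassP_sq u hu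
    linear_combination (1 / 2 : ℂ) * h1.unique (h2.congr_of_eventuallyEq h3)
  rcases AnalyticOnNhd.eq_zero_or_eq_zero_of_mul_eq_zero hP'
    (hP'.deriv.sub ((analyticOnNhd_const.mul (hP.pow 2)).sub analyticOnNhd_const)) hprod
    (isPreconnected_compl_of_countable Λ.countable_lattice) with h | h
  · exfalso
    have h0 : meromorphicOrderAt ℘'[Λ] 0 = -3 := by
      rw [← Λ.deriv_weierstrassP]
      exact meromorphicOrderAt_deriv_eq_sub_one (n := -2) (by norm_num)
        (Λ.order_weierstrassP 0 (zero_mem _))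
    have h1 : meromorphicOrderAt ℘'[Λ] 0 = ⊤ := by
      rw [meromorphicOrderAt_eq_top_iff]
      filter_upwards [self_mem_nhdsWithin, mem_nhdsWithin_of_mem_nhds
        (Λ.compl_lattice_sdiff_singleton_mem_nhds 0)] with w hw hw'
      exact h w fun hwl => hw' ⟨hwl, hw⟩
    rw [h0] at h1
    exact absurd h1 (by decide)
  · exact sub_eq_zero.1 (h z hz)

/-- A solution of `D'' = φ D` with `D(x) = D'(x) = 0` vanishes near `x`. -/
theorem _root_.AnalyticAt.eventually_eq_zero_of_deriv_deriv_eq_mul {D φ : ℂ → ℂ} {x : ℂ}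
    (hD : AnalyticAt ℂ D x) (hφ : AnalyticAt ℂ φ x) (h : deriv (deriv D) =ᶠ[𝓝 x] φ * D)
    (h0 : D x = 0) (h1 : deriv D x = 0) : ∀ᶠ t in 𝓝 x, D t = 0 := by
  have e1 := hD.analyticOrderAt_deriv_add_one
  have e2 := hD.deriv.analyticOrderAt_deriv_add_one
  simp only [h0, h1, sub_zero] at e1 e2
  -- Two differentiations lower a finite order of vanishing by two, while multiplication by `φ`
  -- cannot lower it; hence the order is infinite.
  have e3 : analyticOrderAt (deriv (deriv D)) x = analyticOrderAt φ x + analyticOrderAt D x := by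
    rw [analyticOrderAt_congr h, analyticOrderAt_mul hφ hD]
  rw [← analyticOrderAt_eq_top]
  rw [e3] at e2
  rw [← e2] at e1
  by_contra hne
  lift analyticOrderAt D x to ℕ using hne with n hn
  cases hm : analyticOrderAt φ x with
  | top => simp [hm] at e1
  | coe m =>
    rw [hm] at e1
    norm_cast at e1
    omega

/-- A point of `ℂ / Λ` is determined by the values of `℘` and `℘'`. -/
theorem sub_mem_lattice_of_weierstrassP_eq {z w : ℂ} (hz : z ∉ Λ.lattice) (hw : w ∉ Λ.lattice)
    (h : ℘[Λ] z = ℘[Λ] w) (h' : ℘'[Λ] z = ℘'[Λ] w) : w - z ∈ Λ.lattice := by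
  have hopen : IsOpen (Λ.lattice : Set ℂ)ᶜ := Λ.isClosed_lattice.isOpen_compl
  set F : ℂ → ℂ → ℂ := fun x t => ℘[Λ] (x + t) with hF
  have hFa : ∀ x t, x + t ∉ Λ.lattice → AnalyticAt ℂ (F x) t := fun x t ht =>
    (Λ.analyticOnNhd_weierstrassP _ ht).comp_of_eq (analyticAt_const.add analyticAt_id) rfl
  have hF1 : ∀ x, deriv (F x) = fun t => ℘'[Λ] (x + t) := fun x => by
    ext t
    rw [hF, deriv_comp_const_add, Λ.deriv_weierstrassP]
  have hF2 : ∀ x t, x + t ∉ Λ.lattice →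
      deriv (deriv (F x)) t = 6 * F x t ^ 2 - Λ.g₂ / 2 := fun x t ht => by
    rw [hF1, deriv_comp_const_add, Λ.deriv_derivWeierstrassP ht]
  set U : Set ℂ := ({t | z + t ∈ Λ.lattice} ∪ {t | w + t ∈ Λ.lattice})ᶜ with hU
  have hUc : IsPreconnected U := by
    refine isPreconnected_compl_of_countable (Set.Countable.union ?_ ?_)
    · exact Λ.countable_lattice.preimage (add_right_injective z)
    · exact Λ.countable_lattice.preimage (add_right_injective w)
  have hUo : IsOpen U := by
    rw [hU, Set.compl_union]
    exact (hopen.preimage (continuous_const_add z)).inter (hopen.preimage (continuous_const_add w))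
  have h0U : (0 : ℂ) ∈ U := by simp [hU, hz, hw]
  have hUz : ∀ t ∈ U, z + t ∉ Λ.lattice := fun t ht hm => ht (Or.inl hm)
  have hUw : ∀ t ∈ U, w + t ∉ Λ.lattice := fun t ht hm => ht (Or.inr hm)
  have hloc : F z =ᶠ[𝓝 0] F w := by
    have hz0 := hFa z 0 (hUz 0 h0U)
    have hw0 := hFa w 0 (hUw 0 h0U)
    have hd : ∀ t ∈ U, deriv (F z - F w) t = deriv (F z) t - deriv (F w) t := fun t ht =>
      deriv_sub (hFa z t (hUz t ht)).differentiableAt (hFa w t (hUw t ht)).differentiableAt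
    -- The difference of two solutions of `y'' = 6 y² - g₂/2` solves a linear equation, since `y₁² -
    -- y₂² = (y₁ + y₂)(y₁ - y₂)`.
    have hev := (hz0.sub hw0).eventually_eq_zero_of_deriv_deriv_eq_mul
      (φ := fun t => 6 * (F z t + F w t)) (analyticAt_const.mul (hz0.add hw0)) ?_ ?_ ?_
    · filter_upwards [hev] with t ht using sub_eq_zero.1 ht
    · filter_upwards [hUo.mem_nhds h0U] with t ht
      have e : deriv (F z - F w) =ᶠ[𝓝 t] deriv (F z) - deriv (F w) := by
        filter_upwards [hUo.mem_nhds ht] with u hu using hd u hu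
      rw [e.deriv_eq, deriv_sub (hFa z t (hUz t ht)).deriv.differentiableAt
        (hFa w t (hUw t ht)).deriv.differentiableAt, hF2 z t (hUz t ht), hF2 w t (hUw t ht)]
      simp only [Pi.mul_apply, Pi.sub_apply]
      ring
    · simp [hF, h]
    · rw [hd 0 h0U, hF1, hF1]
      simp [h']
  have hEq : Set.EqOn (F z) (F w) U :=
    AnalyticOnNhd.eqOn_of_preconnected_of_eventuallyEq (fun t ht => hFa z t (hUz t ht))
      (fun t ht => hFa w t (hUw t ht)) hUc h0U hloc
  -- Otherwise `F z` blows up at `t = -z`, where `F w` is analytic, although they agree on a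
  -- punctured neighbourhood.
  by_contra hwz
  have ht1 : Tendsto (F z) (𝓝[≠] (-z)) (Bornology.cobounded ℂ) := by
    refine Λ.tendsto_weierstrassP_cobounded.comp ?_
    refine tendsto_nhdsWithin_iff.2 ⟨?_, ?_⟩
    · have : Tendsto (fun t => z + t) (𝓝 (-z)) (𝓝 (z + -z)) := (continuous_const_add z).tendsto _
      rw [add_neg_cancel] at this
      exact this.mono_left nhdsWithin_le_nhds
    · filter_upwards [self_mem_nhdsWithin] with t ht h0
      exact ht (by simpa using (eq_neg_of_add_eq_zero_right h0))
  have ht2 : Tendsto (F w) (𝓝[≠] (-z)) (𝓝 (F w (-z))) :=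
    (hFa w (-z) (by simpa [sub_eq_add_neg] using hwz)).continuousAt.tendsto.mono_left
      nhdsWithin_le_nhds
  have hev : F z =ᶠ[𝓝[≠] (-z)] F w := by
    have hn1 : ∀ᶠ t in 𝓝 (-z), w + t ∉ Λ.lattice :=
      (hopen.preimage (continuous_const_add w)).mem_nhds
        (by simpa [sub_eq_add_neg] using hwz)
    have hn2 : ∀ᶠ t in 𝓝 (-z), z + t ∉ (Λ.lattice : Set ℂ) \ {0} :=
      (show Tendsto (fun t => z + t) (𝓝 (-z)) (𝓝 0) by
        simpa using (continuous_const_add z).tendsto (-z)).eventually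
        (Λ.compl_lattice_sdiff_singleton_mem_nhds 0)
    filter_upwards [self_mem_nhdsWithin, mem_nhdsWithin_of_mem_nhds hn1,
      mem_nhdsWithin_of_mem_nhds hn2] with t h1 h2 h3
    refine hEq ?_
    rintro (h4 | h4)
    · exact h3 ⟨h4, fun h0 => h1 (by simpa using (eq_neg_of_add_eq_zero_right h0))⟩
    · exact h2 h4
  exact not_tendsto_nhds_of_tendsto_atTop
    (tendsto_norm_cobounded_atTop.comp ht1) _ ((ht2.congr' hev.symm).norm)

theorem derivWeierstrassP_eq_zero_of_two_mul_mem {z : ℂ} (h : 2 * z ∈ Λ.lattice) :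
    ℘'[Λ] z = 0 := by
  have h1 := Λ.derivWeierstrassP_sub_coe z ⟨_, h⟩
  rw [show z - (⟨2 * z, h⟩ : Λ.lattice).1 = -z by simp; ring, derivWeierstrassP_neg] at h1
  exact CharZero.neg_eq_self_iff.1 h1

theorem exists_half_periods : ∃ e : Fin 3 → ℂ, (∀ i, e i ∉ Λ.lattice) ∧
    (∀ i, 2 * e i ∈ Λ.lattice) ∧ Function.Injective fun i => ℘[Λ] (e i) := by
  have key : ∀ α β : ℚ, ¬ (α.den = 1 ∧ β.den = 1) → (α * Λ.ω₁ + β * Λ.ω₂ : ℂ) ∉ Λ.lattice :=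
    fun α β h => Λ.mul_ω₁_add_mul_ω₂_mem_lattice.not.2 h
  have k1 : Λ.ω₁ / 2 ∉ Λ.lattice := Λ.ω₁_div_two_notMem_lattice
  have k2 : Λ.ω₂ / 2 ∉ Λ.lattice := Λ.ω₂_div_two_notMem_lattice
  have k3 : (Λ.ω₁ + Λ.ω₂) / 2 ∉ Λ.lattice := by
    have := key (1 / 2) (1 / 2) (by norm_num)
    convert this using 2
    push_cast; ring
  have k4 : Λ.ω₂ / 2 - Λ.ω₁ / 2 ∉ Λ.lattice := by
    have := key (-1 / 2) (1 / 2) (by norm_num)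
    convert this using 2
    push_cast; ring
  have m1 : 2 * (Λ.ω₁ / 2) ∈ Λ.lattice := by
    rw [mul_div_cancel₀ _ two_ne_zero]; exact Λ.ω₁_mem_lattice
  have m2 : 2 * (Λ.ω₂ / 2) ∈ Λ.lattice := by
    rw [mul_div_cancel₀ _ two_ne_zero]; exact Λ.ω₂_mem_lattice
  have m3 : 2 * ((Λ.ω₁ + Λ.ω₂) / 2) ∈ Λ.lattice := by
    rw [mul_div_cancel₀ _ two_ne_zero]; exact add_mem Λ.ω₁_mem_lattice Λ.ω₂_mem_lattice
  have ne : ∀ {z w : ℂ}, z ∉ Λ.lattice → w ∉ Λ.lattice → 2 * z ∈ Λ.lattice → 2 * w ∈ Λ.lattice →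
      w - z ∉ Λ.lattice → ℘[Λ] z ≠ ℘[Λ] w := fun hz hw hz2 hw2 h he =>
    h (Λ.sub_mem_lattice_of_weierstrassP_eq hz hw he (by
      rw [Λ.derivWeierstrassP_eq_zero_of_two_mul_mem hz2,
        Λ.derivWeierstrassP_eq_zero_of_two_mul_mem hw2]))
  have n12 := ne k1 k2 m1 m2 k4
  have n13 := ne k1 k3 m1 m3 (by convert k2 using 2; ring)
  have n23 := ne k2 k3 m2 m3 (by convert k1 using 2; ring)
  refine ⟨![Λ.ω₁ / 2, Λ.ω₂ / 2, (Λ.ω₁ + Λ.ω₂) / 2], ?_, ?_, ?_⟩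
  · intro i; fin_cases i <;> simp_all
  · intro i; fin_cases i
    exacts [m1, m2, m3]
  · intro i j hij
    match i, j, hij with
    | 0, 0, _ => rfl
    | 0, 1, h => exact absurd h n12
    | 0, 2, h => exact absurd h n13
    | 1, 0, h => exact absurd h n12.symm
    | 1, 1, _ => rfl
    | 1, 2, h => exact absurd h n23
    | 2, 0, h => exact absurd h n13.symm
    | 2, 1, h => exact absurd h n23.symm
    | 2, 2, _ => rfl

/-- The polynomial `4 X³ - g₂ X - g₃` splits over the values of `℘` at the half periods. -/
theorem exists_cubic_factorization : ∃ e : Fin 3 → ℂ, (∀ i, e i ∉ Λ.lattice) ∧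
    (∀ i, 2 * e i ∈ Λ.lattice) ∧ (Function.Injective fun i => ℘[Λ] (e i)) ∧
    ∀ x : ℂ, 4 * x ^ 3 - Λ.g₂ * x - Λ.g₃ =
      4 * (x - ℘[Λ] (e 0)) * (x - ℘[Λ] (e 1)) * (x - ℘[Λ] (e 2)) := by
  obtain ⟨e, h1, h2, h3⟩ := Λ.exists_half_periods
  refine ⟨e, h1, h2, h3, fun x => ?_⟩
  have hr : ∀ i, 4 * ℘[Λ] (e i) ^ 3 - Λ.g₂ * ℘[Λ] (e i) - Λ.g₃ = 0 := fun i => by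
    rw [← Λ.derivWeierstrassP_sq _ (h1 i), Λ.derivWeierstrassP_eq_zero_of_two_mul_mem (h2 i)]
    norm_num
  have n01 : ℘[Λ] (e 0) - ℘[Λ] (e 1) ≠ 0 := sub_ne_zero.2 fun h => absurd (h3 h) (by decide)
  have n02 : ℘[Λ] (e 0) - ℘[Λ] (e 2) ≠ 0 := sub_ne_zero.2 fun h => absurd (h3 h) (by decide)
  have n12 : ℘[Λ] (e 1) - ℘[Λ] (e 2) ≠ 0 := sub_ne_zero.2 fun h => absurd (h3 h) (by decide)
  have r0 := hr 0
  have r1 := hr 1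
  have r2 := hr 2
  generalize ℘[Λ] (e 0) = p at *
  generalize ℘[Λ] (e 1) = q at *
  generalize ℘[Λ] (e 2) = r at *
  have a1 : 4 * (p ^ 2 + p * q + q ^ 2) - Λ.g₂ = 0 :=
    mul_left_cancel₀ n01 (by linear_combination r0 - r1)
  have a2 : 4 * (p ^ 2 + p * r + r ^ 2) - Λ.g₂ = 0 :=
    mul_left_cancel₀ n02 (by linear_combination r0 - r2)
  have a3 : p + q + r = 0 := mul_left_cancel₀ n12 (by linear_combination (1 / 4 : ℂ) * (a1 - a2))
  linear_combination 4 * x ^ 2 * a3 + (x - p) * a1 + r0 - 4 * (x - p) * (p + q) * a3 -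
    4 * p ^ 2 * a3

/-- A zero of `℘'` makes `℘ z` a root of the cubic, hence equal to `℘` at a half period. There `℘'`
vanishes too, so `z` is congruent to that half period. -/
theorem derivWeierstrassP_eq_zero_iff {z : ℂ} (hz : z ∉ Λ.lattice) :
    ℘'[Λ] z = 0 ↔ 2 * z ∈ Λ.lattice := by
  refine ⟨fun h => ?_, Λ.derivWeierstrassP_eq_zero_of_two_mul_mem⟩
  obtain ⟨e, h1, h2, -, h4⟩ := Λ.exists_cubic_factorization
  have h5 := Λ.derivWeierstrassP_sq z hz
  have key : ∀ i, ℘[Λ] z - ℘[Λ] (e i) = 0 → 2 * z ∈ Λ.lattice := fun i hi => by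
    have h6 := Λ.sub_mem_lattice_of_weierstrassP_eq hz (h1 i) (sub_eq_zero.1 hi)
      (by rw [h, Λ.derivWeierstrassP_eq_zero_of_two_mul_mem (h2 i)])
    have h7 := sub_mem (h2 i) (add_mem h6 h6)
    convert h7 using 1
    ring
  rw [h, h4] at h5
  have h8 : (℘[Λ] z - ℘[Λ] (e 0)) * (℘[Λ] z - ℘[Λ] (e 1)) * (℘[Λ] z - ℘[Λ] (e 2)) = 0 := by
    linear_combination -(1 / 4 : ℂ) * h5
  rcases mul_eq_zero.1 h8 with h8 | h8
  · rcases mul_eq_zero.1 h8 with h8 | h8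
    exacts [key 0 h8, key 1 h8]
  · exact key 2 h8

/-- By `℘''' = 12 ℘ ℘'`, a multiple zero would force `℘' = 0` off the lattice, making every point
half a lattice point; `ω₁ / 4` refutes this. -/
theorem deriv_derivWeierstrassP_ne_zero {z : ℂ} (hz : z ∉ Λ.lattice) (h : ℘'[Λ] z = 0) :
    deriv ℘'[Λ] z ≠ 0 := by
  intro h0
  have hev : ∀ᶠ t in 𝓝 z, ℘'[Λ] t = 0 := by
    have hP := Λ.analyticOnNhd_weierstrassP z hz
    have hopen : IsOpen (Λ.lattice : Set ℂ)ᶜ := Λ.isClosed_lattice.isOpen_compl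
    refine (Λ.analyticOnNhd_derivWeierstrassP z hz).eventually_eq_zero_of_deriv_deriv_eq_mul
      (φ := fun t => 12 * ℘[Λ] t) (analyticAt_const.mul hP) ?_ h h0
    filter_upwards [hopen.mem_nhds hz] with t ht
    have e : deriv ℘'[Λ] =ᶠ[𝓝 t] fun u => 6 * ℘[Λ] u ^ 2 - Λ.g₂ / 2 := by
      filter_upwards [hopen.mem_nhds ht] with u hu using Λ.deriv_derivWeierstrassP hu
    have hd : HasDerivAt ℘[Λ] (℘'[Λ] t) t := by
      rw [← Λ.deriv_weierstrassP]
      exact (Λ.analyticOnNhd_weierstrassP t ht).differentiableAt.hasDerivAt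
    have hd2 : HasDerivAt (fun u => 6 * ℘[Λ] u ^ 2 - Λ.g₂ / 2) (6 * (2 * ℘[Λ] t * ℘'[Λ] t)) t := by
      simpa using! ((hd.pow 2).const_mul 6).sub_const (Λ.g₂ / 2)
    rw [e.deriv_eq, hd2.deriv]
    simp only [Pi.mul_apply]
    ring
  have hall := AnalyticOnNhd.eqOn_zero_of_preconnected_of_eventuallyEq_zero
    Λ.analyticOnNhd_derivWeierstrassP (isPreconnected_compl_of_countable Λ.countable_lattice) hz hev
  have key : ∀ u : ℂ, 2 * u ∈ Λ.lattice := fun u => by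
    by_cases hu : u ∈ Λ.lattice
    · rw [two_mul]; exact add_mem hu hu
    · exact (Λ.derivWeierstrassP_eq_zero_iff hu).1 (hall hu)
  apply Λ.ω₁_div_two_notMem_lattice
  convert key (Λ.ω₁ / 4) using 1
  ring

/-! ### Liouville's theorem modulo a lattice. -/

/-- Two functions that are analytic off `s + Λ`, `Λ`-periodic there, and differ near `s` by an
analytic function, differ by a constant. -/
theorem exists_const_of_analyticAt_off {F K : ℂ → ℂ} {s : ℂ}
    (hF : ∀ z, z - s ∉ Λ.lattice → AnalyticAt ℂ F z)
    (hper : ∀ z, ∀ ω ∈ Λ.lattice, F (z + ω) = F z)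
    (hK : AnalyticAt ℂ K s) (hFK : F =ᶠ[𝓝[≠] s] K) :
    ∃ c, ∀ z, z - s ∉ Λ.lattice → F z = c := by
  classical
  -- Filling the removable singularities with `K s` yields an entire periodic function, bounded
  -- because its range is compact.
  set H : ℂ → ℂ := fun z => if z - s ∈ Λ.lattice then K s else F z with hH
  have hHper : ∀ z, ∀ ω ∈ Λ.lattice, H (z + ω) = H z := fun z ω hω => by
    have : z + ω - s ∈ Λ.lattice ↔ z - s ∈ Λ.lattice := by
      rw [add_sub_right_comm]
      exact Submodule.add_mem_iff_left _ hω
    simp only [hH, this, hper z ω hω]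
  have hopen : IsOpen (Λ.lattice : Set ℂ)ᶜ := Λ.isClosed_lattice.isOpen_compl
  have hs : AnalyticAt ℂ H s := by
    refine hK.congr ?_
    have hn : ∀ᶠ t in 𝓝 s, t - s ∉ (Λ.lattice : Set ℂ) \ {0} :=
      (show Tendsto (fun t => t - s) (𝓝 s) (𝓝 0) by
        simpa using (continuous_sub_right s).tendsto s).eventually
        (Λ.compl_lattice_sdiff_singleton_mem_nhds 0)
    filter_upwards [hn, eventually_nhdsWithin_iff.1 hFK] with t h1 h2
    by_cases hts : t = s
    · simp [hH, hts]
    · have : t - s ∉ Λ.lattice := fun h => h1 ⟨h, sub_ne_zero.2 hts⟩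
      simp [hH, this, h2 hts]
  have hdiff : Differentiable ℂ H := fun z => by
    by_cases hz : z - s ∈ Λ.lattice
    · have e : H = fun t => H (t - (z - s)) := by
        ext t
        rw [sub_eq_add_neg, hHper t _ (neg_mem hz)]
      rw [e]
      have : AnalyticAt ℂ H (z - (z - s)) := by simpa using hs
      exact this.differentiableAt.comp z (differentiableAt_id.sub_const (z - s))
    · refine ((hF z hz).congr ?_).differentiableAt
      filter_upwards [(hopen.preimage (continuous_sub_right s)).mem_nhds hz] with t ht
      have : t - s ∉ Λ.lattice := ht
      simp [hH, this]
  refine ⟨H s, fun z hz => ?_⟩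
  have := hdiff.apply_eq_apply_of_bounded (IsZLattice.isCompact_range_of_periodic Λ.lattice _
    hdiff.continuous hHper).isBounded z s
  simpa [hH, hz] using this

end PeriodPair

/-! ### Hyperbolic identities and the integrand. -/

theorem Complex.cosh_eq_zero_iff {z : ℂ} :
    Complex.cosh z = 0 ↔ ∃ n : ℤ, z = Real.pi * Complex.I / 2 + n * (Real.pi * Complex.I) := by
  rw [← Complex.cos_mul_I, Complex.cos_eq_zero_iff]
  constructor
  · rintro ⟨n, hn⟩
    refine ⟨-n - 1, ?_⟩
    push_cast
    linear_combination (-Complex.I) * hn + z * Complex.I_mul_I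
  · rintro ⟨n, hn⟩
    refine ⟨-n - 1, ?_⟩
    push_cast
    linear_combination Complex.I * hn + (Real.pi / 2 + n * Real.pi) * Complex.I_mul_I

theorem Complex.cosh_add_pi_mul_I_div_two (z : ℂ) :
    Complex.cosh (z + Real.pi * Complex.I / 2) = Complex.I * Complex.sinh z := by
  have h : (Real.pi : ℂ) * Complex.I / 2 = (Real.pi / 2 : ℂ) * Complex.I := by ring
  rw [h, Complex.cosh_add, Complex.cosh_mul_I, Complex.sinh_mul_I, Complex.cos_pi_div_two,
    Complex.sin_pi_div_two]
  ring

theorem Complex.abs_re_le_norm_sinh (z : ℂ) : |z.re| ≤ ‖Complex.sinh z‖ := by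
  have h1 : |Real.sinh z.re| ≤ ‖Complex.sinh z‖ := by
    have h2 := abs_norm_sub_norm_le (Complex.exp z) (Complex.exp (-z))
    rw [Complex.norm_exp, Complex.norm_exp, Complex.neg_re] at h2
    have h3 : ‖Complex.sinh z‖ = ‖Complex.exp z - Complex.exp (-z)‖ / 2 := by
      rw [Complex.sinh, norm_div, Complex.norm_two]
    rw [Real.sinh_eq, abs_div, abs_two, h3]
    gcongr
  refine le_trans ?_ h1
  rw [Real.abs_sinh]
  exact Real.self_le_sinh_iff.2 (abs_nonneg _)

/-- `cosh (s + h / 2) cosh (s - h / 2)`, the denominator of the Melnikov integrand. -/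
noncomputable def muDen (a b : ℝ) (s : ℂ) : ℂ :=
  Complex.cosh (s + (charExponent a b : ℂ) / 2) * Complex.cosh (s - (charExponent a b : ℂ) / 2)

theorem complex_cosh_charExponent {a b : ℝ} (hb : 0 < b) (hab : b < a) :
    Complex.cosh ((charExponent a b : ℂ) / 2) = (a : ℂ) / b := by
  have := congrArg (fun x : ℝ => (x : ℂ)) (cosh_charExponent hb hab)
  simpa using this

theorem muDen_eq {a b : ℝ} (hb : 0 < b) (hab : b < a) (s : ℂ) :
    muDen a b s = ((a : ℂ) / b) ^ 2 + Complex.sinh s ^ 2 := by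
  rw [muDen, Complex.cosh_add, Complex.cosh_sub, ← complex_cosh_charExponent hb hab]
  have h1 := Complex.cosh_sq (s)
  have h2 := Complex.cosh_sq ((charExponent a b : ℂ) / 2)
  linear_combination Complex.cosh ((charExponent a b : ℂ) / 2) ^ 2 * h1 + Complex.sinh s ^ 2 * h2

/-- No exceptional points are needed: where `cosh s` or `muDen` vanishes, division by zero gives `a
/ b ^ 3` on both sides. -/
theorem muHatC_eq {a b : ℝ} (hb : 0 < b) (hab : b < a) (s : ℂ) :
    muHatC a b s = (a : ℂ) / b ^ 3 * (1 - Complex.cosh s ^ 4 / muDen a b s ^ 2) := by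
  have hb0 : (b : ℂ) ≠ 0 := by exact_mod_cast hb.ne'
  rw [muHatC]
  by_cases hc : Complex.cosh s = 0
  · simp [hc, Complex.tanh]
  have e : (a : ℂ) ^ 2 * (Complex.cosh s)⁻¹ ^ 2 + (b : ℂ) ^ 2 * Complex.tanh s ^ 2 =
      b ^ 2 * muDen a b s / Complex.cosh s ^ 2 := by
    rw [muDen_eq hb hab, Complex.tanh]
    field_simp
  rw [e]
  by_cases hd : muDen a b s = 0
  · simp [hd]
  · field_simp

theorem muDen_eq_zero_iff {a b : ℝ} {s : ℂ} : muDen a b s = 0 ↔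
    (∃ n : ℤ, s = sPlus a b + n * (Real.pi * Complex.I)) ∨
      ∃ n : ℤ, s = sMinus a b + n * (Real.pi * Complex.I) := by
  rw [muDen, mul_eq_zero, or_comm, Complex.cosh_eq_zero_iff, Complex.cosh_eq_zero_iff]
  refine or_congr (exists_congr fun n => ?_) (exists_congr fun n => ?_) <;>
    simp only [sPlus, sMinus] <;>
    constructor <;> intro h <;> linear_combination h

theorem muHatC_neg (a b : ℝ) (s : ℂ) : muHatC a b (-s) = muHatC a b s := by
  simp [muHatC]

theorem muHatC_add_pi_mul_I {a b : ℝ} (s : ℂ) :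
    muHatC a b (s + Real.pi * Complex.I) = muHatC a b s := by
  simp only [muHatC, Complex.tanh, Complex.cosh_add_pi_mul_I, Complex.sinh_add_pi_mul_I,
    neg_div_neg_eq, inv_neg, neg_sq]

theorem analyticAt_muDen (a b : ℝ) (s : ℂ) : AnalyticAt ℂ (muDen a b) s := by
  have : Differentiable ℂ (muDen a b) := by
    unfold muDen
    fun_prop
  exact this.analyticAt s

theorem analyticAt_muHatC {a b : ℝ} (hb : 0 < b) (hab : b < a) {s : ℂ} (hs : muDen a b s ≠ 0) :
    AnalyticAt ℂ (muHatC a b) s := by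
  rw [funext (muHatC_eq hb hab)]
  have h1 : AnalyticAt ℂ Complex.cosh s := Complex.differentiable_cosh.analyticAt s
  exact analyticAt_const.mul (analyticAt_const.sub
    ((h1.pow 4).div ((analyticAt_muDen a b s).pow 2) (pow_ne_zero 2 hs)))

/-- Quadratic decay of the Melnikov integrand in the real direction. -/
theorem exists_muHatC_bound {a b : ℝ} (hb : 0 < b) (hab : b < a) :
    ∃ R K : ℝ, 0 < R ∧ 0 < K ∧ ∀ s : ℂ, R ≤ |s.re| →
      muDen a b s ≠ 0 ∧ ‖muHatC a b s‖ ≤ K / s.re ^ 2 := by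
  have ha : 0 < a := hb.trans hab
  set c : ℝ := a / b with hc
  have hc1 : 1 < c := (one_lt_div hb).2 hab
  set S : ℝ := c ^ 2 - 1 with hS
  have hS0 : 0 < S := by nlinarith
  -- For `|Re s| ≥ 2c` one has `c² ≤ (Re s)² / 4`, so `|muDen| ≥ |sinh s|² - c² ≥ (Re s)² / 2`.
  refine ⟨2 * c, a / b ^ 3 * (4 * S + 4 * S ^ 2), by positivity, by positivity, fun s hs => ?_⟩
  have hx1 : 4 * c ^ 2 ≤ s.re ^ 2 := by
    rw [← sq_abs s.re]
    nlinarith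
  have hx0 : 1 ≤ s.re ^ 2 := by nlinarith
  have hx00 : 0 < s.re ^ 2 := by linarith
  have hD : s.re ^ 2 / 2 ≤ ‖muDen a b s‖ := by
    have h1 : ‖Complex.sinh s‖ ^ 2 ≥ s.re ^ 2 := by
      rw [← sq_abs s.re]
      exact pow_le_pow_left₀ (abs_nonneg _) (Complex.abs_re_le_norm_sinh s) 2
    have h2 : muDen a b s = Complex.sinh s ^ 2 - (-((c ^ 2 : ℝ) : ℂ)) := by
      rw [muDen_eq hb hab, hc]
      push_cast
      ring
    have h3 := norm_sub_norm_le (Complex.sinh s ^ 2) (-((c ^ 2 : ℝ) : ℂ))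
    rw [← h2, norm_pow, norm_neg, Complex.norm_real, Real.norm_of_nonneg (by positivity)] at h3
    linarith
  have hD0 : muDen a b s ≠ 0 := norm_pos_iff.1 (by linarith)
  refine ⟨hD0, ?_⟩
  -- Since `cosh² = muDen - S`, the constant term cancels and only negative powers of `muDen`
  -- remain.
  have e : muHatC a b s = (a : ℂ) / b ^ 3 *
      (2 * (S : ℂ) / muDen a b s - (S : ℂ) ^ 2 / muDen a b s ^ 2) := by
    rw [muHatC_eq hb hab]
    have h4 : Complex.cosh s ^ 2 = muDen a b s - S := by
      rw [muDen_eq hb hab, Complex.cosh_sq, hS, hc]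
      push_cast
      ring
    rw [show Complex.cosh s ^ 4 = (Complex.cosh s ^ 2) ^ 2 by ring, h4]
    field_simp
    ring
  have n1 : ‖(a : ℂ) / b ^ 3‖ = a / b ^ 3 := by
    rw [norm_div, norm_pow, Complex.norm_real, Complex.norm_real, Real.norm_of_nonneg ha.le,
      Real.norm_of_nonneg hb.le]
  rw [e, norm_mul, n1, mul_div_assoc (a / b ^ 3)]
  gcongr
  refine (norm_sub_le _ _).trans ?_
  rw [norm_div, norm_div, norm_mul, norm_pow, norm_pow, Complex.norm_two, Complex.norm_real,
    Real.norm_of_nonneg hS0.le, add_div]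
  have h5 : 2 * S / ‖muDen a b s‖ ≤ 4 * S / s.re ^ 2 := by
    rw [div_le_div_iff₀ (by linarith) hx00]
    nlinarith
  have h6 : S ^ 2 / ‖muDen a b s‖ ^ 2 ≤ 4 * S ^ 2 / s.re ^ 2 := by
    have h7 : s.re ^ 2 / 4 ≤ ‖muDen a b s‖ ^ 2 := by nlinarith
    rw [div_le_div_iff₀ (by nlinarith) hx00]
    nlinarith [sq_nonneg S]
  linarith

/-! ### Convergence, analyticity and periodicity of the series. -/

theorem exists_summable_bound {a b : ℝ} (hb : 0 < b) (hab : b < a) (N : ℝ) :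
    ∃ (T : Finset ℤ) (u : ℤ → ℝ), Summable u ∧ ∀ j ∉ T, ∀ z : ℂ, |z.re| < N →
      muDen a b (z + (j : ℂ) * (charExponent a b : ℂ)) ≠ 0 ∧
      ‖muHatC a b (z + (j : ℂ) * (charExponent a b : ℂ))‖ ≤ u j := by
  obtain ⟨R, K, hR, hK, h⟩ := exists_muHatC_bound hb hab
  have hh := charExponent_pos hb hab
  set η := charExponent a b with hη
  -- Beyond this `M`, half of `|j| η` absorbs `|Re z|` and `R`; the other half supplies the `1 / j²`
  -- majorant.
  obtain ⟨M, hM⟩ := exists_nat_gt ((2 * |N| + 2 * R) / η)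
  refine ⟨Finset.Icc (-(M : ℤ)) M, fun j => 4 * K / η ^ 2 * (1 / (j : ℝ) ^ 2),
    (Real.summable_one_div_int_pow.2 one_lt_two).mul_left _, fun j hj z hz => ?_⟩
  have hjM : (M : ℝ) ≤ |(j : ℝ)| := by
    have : (M : ℤ) ≤ |j| := by
      by_contra hcon
      rw [not_le, abs_lt] at hcon
      exact hj (Finset.mem_Icc.2 ⟨hcon.1.le, hcon.2.le⟩)
    exact_mod_cast this
  have hre : (z + (j : ℂ) * (η : ℂ)).re = z.re + j * η := by simp
  have h1 : 2 * |N| + 2 * R < |(j : ℝ)| * η := by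
    rw [div_lt_iff₀ hh] at hM
    nlinarith
  have h2 : |(j : ℝ)| * η / 2 + R ≤ |z.re + j * η| := by
    have h3 := abs_sub_abs_le_abs_sub ((j : ℝ) * η) (-z.re)
    rw [abs_neg, abs_mul, abs_of_pos hh, sub_neg_eq_add, add_comm ((j : ℝ) * η)] at h3
    have := le_abs_self N
    linarith
  have hj0 : 0 < |(j : ℝ)| * η / 2 := by
    have := abs_nonneg N
    linarith
  obtain ⟨h4, h5⟩ := h (z + (j : ℂ) * (η : ℂ)) (by rw [hre]; linarith)
  refine ⟨h4, h5.trans ?_⟩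
  rw [hre]
  have h6 : (|(j : ℝ)| * η / 2) ^ 2 ≤ (z.re + j * η) ^ 2 := by
    rw [← sq_abs (z.re + j * η)]
    exact pow_le_pow_left₀ hj0.le (by linarith) 2
  calc K / (z.re + j * η) ^ 2 ≤ K / (|(j : ℝ)| * η / 2) ^ 2 :=
        div_le_div_of_nonneg_left hK.le (by positivity) h6
    _ = 4 * K / η ^ 2 * (1 / (j : ℝ) ^ 2) := by
        rw [div_pow, mul_pow, sq_abs]
        have : (j : ℝ) ≠ 0 := by
          rintro h0
          rw [h0] at hj0
          simp at hj0
        field_simp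
        norm_num

theorem summable_muHatC {a b : ℝ} (hb : 0 < b) (hab : b < a) (z : ℂ) :
    Summable fun j : ℤ => muHatC a b (z + (j : ℂ) * (charExponent a b : ℂ)) := by
  obtain ⟨T, u, hu, h⟩ := exists_summable_bound hb hab (|z.re| + 1)
  refine Summable.of_norm_bounded_eventually hu ?_
  rw [eventually_cofinite]
  refine T.finite_toSet.subset fun j hj => ?_
  by_contra hjT
  exact hj (h j hjT z (by linarith)).2

/-- Used with `E = ∅` for analyticity off the poles, and with two indices to read off the principal
part at `s₊`. -/
theorem exists_tsum_muHatC_eq {a b : ℝ} (hb : 0 < b) (hab : b < a) (z₀ : ℂ) (E : Finset ℤ)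
    (hE : ∀ j : ℤ, muDen a b (z₀ + (j : ℂ) * (charExponent a b : ℂ)) = 0 → j ∈ E) :
    ∃ R : ℂ → ℂ, AnalyticAt ℂ R z₀ ∧ ∀ z,
      ∑' j : ℤ, muHatC a b (z + (j : ℂ) * (charExponent a b : ℂ)) =
        ∑ j ∈ E, muHatC a b (z + (j : ℂ) * (charExponent a b : ℂ)) + R z := by
  obtain ⟨T, u, hu, h⟩ := exists_summable_bound hb hab (|z₀.re| + 1)
  have hshift : ∀ (j : ℤ) (z : ℂ), muDen a b (z + (j : ℂ) * (charExponent a b : ℂ)) ≠ 0 →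
      AnalyticAt ℂ (fun z => muHatC a b (z + (j : ℂ) * (charExponent a b : ℂ))) z :=
    fun j z hz => (analyticAt_muHatC hb hab hz).comp_of_eq
      (analyticAt_id.add analyticAt_const) rfl
  refine ⟨fun z => ∑ j ∈ T \ E, muHatC a b (z + (j : ℂ) * (charExponent a b : ℂ)) +
    ∑' j : ↑((E ∪ T : Finset ℤ) : Set ℤ)ᶜ, muHatC a b (z + ((j : ℤ) : ℂ) * (charExponent a b : ℂ)),
    ?_, fun z => ?_⟩
  · refine AnalyticAt.add ?_ ?_
    · refine Finset.analyticAt_fun_sum _ fun j hj => hshift j z₀ fun h0 => ?_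
      exact (Finset.mem_sdiff.1 hj).2 (hE j h0)
    · have hU : IsOpen {z : ℂ | |z.re| < |z₀.re| + 1} :=
        isOpen_lt (by fun_prop) continuous_const
      refine DifferentiableOn.analyticAt (s := {z : ℂ | |z.re| < |z₀.re| + 1}) ?_
        (hU.mem_nhds (by simp))
      have hT : ∀ j : ↑((E ∪ T : Finset ℤ) : Set ℤ)ᶜ, (j : ℤ) ∉ T := fun j hj =>
        j.2 (by simp [hj])
      refine Complex.differentiableOn_tsum_of_summable_norm (u := fun j => u (j : ℤ))
        (hu.subtype _) (fun j z hz => ?_) hU fun j z hz => (h j (hT j) z hz).2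
      exact (hshift j z (h j (hT j) z hz).1).differentiableAt.differentiableWithinAt
  · rw [← (summable_muHatC hb hab z).sum_add_tsum_compl (s := E ∪ T),
      ← Finset.sum_sdiff (Finset.subset_union_left (s₁ := E) (s₂ := T)), Finset.union_sdiff_left]
    ring

theorem mem_melnikovPoles_iff {a b : ℝ} (hb : 0 < b) (hab : b < a) {z : ℂ} :
    z ∈ melnikovPoles a b ↔ z - sPlus a b ∈ (homoclinicPeriods hb hab).lattice := by
  rw [PeriodPair.mem_lattice]
  refine exists_congr fun m => exists_congr fun n => ?_
  simp only [homoclinicPeriods]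
  constructor <;> intro h <;> linear_combination -h

theorem mem_melnikovPoles_of_muDen_eq_zero {a b : ℝ} {z : ℂ} {j : ℤ}
    (h : muDen a b (z + (j : ℂ) * (charExponent a b : ℂ)) = 0) : z ∈ melnikovPoles a b := by
  rcases muDen_eq_zero_iff.1 h with ⟨n, hn⟩ | ⟨n, hn⟩
  · refine ⟨-j, n, ?_⟩
    push_cast
    linear_combination hn
  · refine ⟨-j - 1, n, ?_⟩
    simp only [sPlus, sMinus] at hn ⊢
    push_cast
    linear_combination hn

theorem analyticAt_melnikovPotentialC {a b : ℝ} (hb : 0 < b) (hab : b < a) {z : ℂ}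
    (hz : z ∉ melnikovPoles a b) : AnalyticAt ℂ (melnikovPotentialC a b) z := by
  obtain ⟨R, hR, h⟩ := exists_tsum_muHatC_eq hb hab z ∅
    fun j hj => absurd (mem_melnikovPoles_of_muDen_eq_zero hj) hz
  have : melnikovPotentialC a b = fun z => 2 * (b : ℂ) * R z := by
    ext w
    rw [melnikovPotentialC, h w]
    simp
  rw [this]
  exact analyticAt_const.mul hR

theorem melnikovPotentialC_neg (a b : ℝ) (z : ℂ) :
    melnikovPotentialC a b (-z) = melnikovPotentialC a b z := by
  rw [melnikovPotentialC, melnikovPotentialC, ← (Equiv.neg ℤ).tsum_eq]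
  congr 2
  ext j
  rw [← muHatC_neg]
  congr 1
  simp
  ring

theorem melnikovPotentialC_add_lattice {a b : ℝ} (hb : 0 < b) (hab : b < a) (z : ℂ) {ω : ℂ}
    (hω : ω ∈ (homoclinicPeriods hb hab).lattice) :
    melnikovPotentialC a b (z + ω) = melnikovPotentialC a b z := by
  have h1 : Function.Periodic (melnikovPotentialC a b) (charExponent a b : ℂ) := fun w => by
    rw [melnikovPotentialC, melnikovPotentialC, ← (Equiv.addRight (1 : ℤ)).tsum_eq (fun j : ℤ =>
      muHatC a b (w + (j : ℂ) * (charExponent a b : ℂ)))]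
    congr 2
    ext j
    congr 1
    simp
    ring
  have h2 : Function.Periodic (melnikovPotentialC a b) (Real.pi * Complex.I : ℂ) := fun w => by
    rw [melnikovPotentialC, melnikovPotentialC]
    congr 2
    ext j
    rw [add_right_comm, muHatC_add_pi_mul_I]
  obtain ⟨m, n, rfl⟩ := PeriodPair.mem_lattice.1 hω
  simp only [homoclinicPeriods]
  rw [← add_assoc, h2.int_mul n, h1.int_mul m]

/-! ### Laurent expansions and the comparison with `℘`. -/

theorem exists_sinh_eq_mul : ∃ q : ℂ → ℂ, AnalyticAt ℂ q 0 ∧ q 0 = 1 ∧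
    ∀ z, Complex.sinh z = z * q z := by
  refine ⟨dslope Complex.sinh 0, ?_, by simp [Complex.deriv_sinh], fun z => ?_⟩
  · have : DifferentiableOn ℂ (dslope Complex.sinh 0) Set.univ :=
      (Complex.differentiableOn_dslope univ_mem).2 Complex.differentiable_sinh.differentiableOn
    exact this.analyticAt univ_mem
  · simpa using (sub_smul_dslope Complex.sinh 0 z).symm

/-- The shift by `π i / 2` turns `cosh` into `I * sinh`, so the integrand becomes `a / b ^ 3 * (1 -
g σ / σ ^ 2)` with `g` analytic and `g 0 ≠ 0`. The coefficients come from the Taylor expansion of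
`g`. -/
theorem exists_laurent_muHatC_sPlus {a b : ℝ} (hb : 0 < b) (hab : b < a) :
    ∃ (β₂ β₁ : ℂ) (R : ℂ → ℂ), β₂ ≠ 0 ∧ AnalyticAt ℂ R 0 ∧ ∀ᶠ σ in 𝓝[≠] (0 : ℂ),
      muHatC a b (sPlus a b + σ) = β₂ / σ ^ 2 + β₁ / σ + R σ := by
  have hh := charExponent_pos hb hab
  have ha : (a : ℂ) ≠ 0 := by exact_mod_cast (hb.trans hab).ne'
  have hb0 : (b : ℂ) ≠ 0 := by exact_mod_cast hb.ne'
  set η := charExponent a b with hη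
  obtain ⟨q, hq, hq0, hsq⟩ := exists_sinh_eq_mul
  have hs : ∀ x : ℝ, 0 < x → Complex.sinh (x : ℂ) ≠ 0 := fun x hx => by
    rw [← Complex.ofReal_sinh]
    exact_mod_cast (Real.sinh_pos_iff.2 hx).ne'
  have hsη : Complex.sinh (η : ℂ) ≠ 0 := hs η hh
  have hsη2 : Complex.sinh ((η : ℂ) / 2) ≠ 0 := by
    have := hs (η / 2) (by positivity)
    simpa using this
  have han : ∀ c x : ℂ, AnalyticAt ℂ (fun σ => Complex.sinh (c + σ)) x := fun c x => by
    have : Differentiable ℂ (fun σ => Complex.sinh (c + σ)) := by fun_prop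
    exact this.analyticAt x
  set g : ℂ → ℂ := fun σ =>
    Complex.sinh (η / 2 + σ) ^ 4 / (Complex.sinh (η + σ) * q σ) ^ 2 with hg
  have hga : AnalyticAt ℂ g 0 := by
    refine ((han _ 0).pow 4).div (((han _ 0).mul hq).pow 2) ?_
    simp [hq0, hsη]
  have hg0 : g 0 ≠ 0 := by
    simp [hg, hq0, hsη, hsη2]
  obtain ⟨F, hF, hFe⟩ := hga.exists_eventuallyEq_sum_add_pow_mul 2
  refine ⟨-(a / b ^ 3 * g 0), -(a / b ^ 3 * deriv g 0), fun σ => a / b ^ 3 * (1 - F σ), ?_,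
    analyticAt_const.mul (analyticAt_const.sub hF), ?_⟩
  · exact neg_ne_zero.2 (mul_ne_zero (div_ne_zero ha (pow_ne_zero 3 hb0)) hg0)
  have hqne : ∀ᶠ σ in 𝓝 (0 : ℂ), q σ ≠ 0 :=
    hq.continuousAt.eventually_ne (by simp [hq0])
  have hsne : ∀ᶠ σ in 𝓝 (0 : ℂ), Complex.sinh (η + σ) ≠ 0 :=
    (han η 0).continuousAt.eventually_ne (by simpa using hsη)
  filter_upwards [self_mem_nhdsWithin, mem_nhdsWithin_of_mem_nhds hqne,
    mem_nhdsWithin_of_mem_nhds hsne, mem_nhdsWithin_of_mem_nhds hFe] with σ h0 h1 h2 h3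
  have h0' : σ ≠ 0 := h0
  have e1 : Complex.cosh (sPlus a b + σ) = Complex.I * Complex.sinh (η / 2 + σ) := by
    rw [← Complex.cosh_add_pi_mul_I_div_two, sPlus]
    congr 1
    ring
  have e2 : muDen a b (sPlus a b + σ) = -(Complex.sinh (η + σ) * (σ * q σ)) := by
    rw [muDen, sPlus, ← hsq,
      show (η : ℂ) / 2 + Real.pi * Complex.I / 2 + σ + η / 2 = η + σ + Real.pi * Complex.I / 2 by
        ring,
      show (η : ℂ) / 2 + Real.pi * Complex.I / 2 + σ - η / 2 = σ + Real.pi * Complex.I / 2 by ring,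
      Complex.cosh_add_pi_mul_I_div_two, Complex.cosh_add_pi_mul_I_div_two]
    linear_combination Complex.sinh (η + σ) * Complex.sinh σ * Complex.I_mul_I
  have e3 : muHatC a b (sPlus a b + σ) = a / b ^ 3 * (1 - g σ / σ ^ 2) := by
    rw [muHatC_eq hb hab, e1, e2, hg, mul_pow, Complex.I_pow_four]
    congr 2
    field_simp
  have e4 : g σ = g 0 + σ * deriv g 0 + σ ^ 2 * F σ := by
    rw [h3]
    simp [Finset.sum_range_succ]
  rw [e3, e4]
  field_simp
  ring

theorem muHatC_sMinus_add (a b : ℝ) (σ : ℂ) :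
    muHatC a b (sMinus a b + σ) = muHatC a b (sPlus a b + -σ) := by
  rw [← muHatC_neg, ← muHatC_add_pi_mul_I]
  congr 1
  simp only [sPlus, sMinus]
  ring

theorem tendsto_neg_nhdsNE_zero : Tendsto (fun σ : ℂ => -σ) (𝓝[≠] 0) (𝓝[≠] 0) := by
  refine tendsto_nhdsWithin_iff.2 ⟨?_, ?_⟩
  · have : Tendsto (fun σ : ℂ => -σ) (𝓝 0) (𝓝 (-0)) := continuous_neg.tendsto 0
    rw [neg_zero] at this
    exact this.mono_left nhdsWithin_le_nhds
  · filter_upwards [self_mem_nhdsWithin] with σ hσ using neg_ne_zero.2 hσ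

theorem AnalyticAt.isBigO_one_nhdsNE {R : ℂ → ℂ} {x : ℂ} (hR : AnalyticAt ℂ R x) :
    R =O[𝓝[≠] x] fun _ => (1 : ℂ) :=
  (hR.continuousAt.tendsto.mono_left nhdsWithin_le_nhds).isBigO_one ℂ

/-- The Laurent coefficients of `μ̂₁`, and the principal part of `L̂₁` at `h / 2 + π i / 2`. -/
theorem exists_laurent_melnikovPotentialC {a b : ℝ} (hb : 0 < b) (hab : b < a) :
    ∃ (β₂ β₁ : ℂ) (K : ℂ → ℂ), β₂ ≠ 0 ∧ AreLaurentCoeffs a b β₂ β₁ ∧ AnalyticAt ℂ K 0 ∧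
      ∀ᶠ σ in 𝓝[≠] (0 : ℂ),
        melnikovPotentialC a b (sPlus a b + σ) = 4 * b * β₂ / σ ^ 2 + K σ := by
  obtain ⟨β₂, β₁, R, hβ, hR, h⟩ := exists_laurent_muHatC_sPlus hb hab
  have hRn : AnalyticAt ℂ (fun σ => R (-σ)) 0 :=
    AnalyticAt.comp_of_eq hR analyticAt_id.neg (by simp)
  have h' : ∀ᶠ σ in 𝓝[≠] (0 : ℂ),
      muHatC a b (sMinus a b + σ) = β₂ / σ ^ 2 - β₁ / σ + R (-σ) := by
    filter_upwards [tendsto_neg_nhdsNE_zero.eventually h] with σ hσ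
    rw [muHatC_sMinus_add, hσ, neg_sq, div_neg]
    ring
  have hh := charExponent_pos hb hab
  -- Comparing real parts with those of `s₊` and `s₋` leaves only `j = 0` and `j = -1` as singular
  -- indices.
  obtain ⟨Q, hQ, hQe⟩ := exists_tsum_muHatC_eq hb hab (sPlus a b) {0, -1} fun j hj => by
    have key : ∀ x : ℂ, (∃ n : ℤ, sPlus a b + (j : ℂ) * (charExponent a b : ℂ) =
        x + n * (Real.pi * Complex.I)) → charExponent a b / 2 + j * charExponent a b = x.re := by
      rintro x ⟨n, hn⟩
      have := congrArg Complex.re hn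
      simpa [sPlus] using this
    rcases muDen_eq_zero_iff.1 hj with h0 | h0
    · have h1 := key _ h0
      simp only [sPlus] at h1
      have h2 : (j : ℝ) * charExponent a b = 0 := by
        simpa using h1
      have h3 : (j : ℝ) = 0 := (mul_eq_zero.1 h2).resolve_right hh.ne'
      have h4 : j = 0 := by exact_mod_cast h3
      simp [h4]
    · have h1 := key _ h0
      have h2 : ((j : ℝ) + 1) * charExponent a b = 0 := by
        have : (sMinus a b).re = -charExponent a b / 2 := by simp [sMinus]
        rw [this] at h1
        linarith
      have h3 : (j : ℝ) + 1 = 0 := (mul_eq_zero.1 h2).resolve_right hh.ne'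
      have h4 : j + 1 = 0 := by exact_mod_cast h3
      have h5 : j = -1 := by omega
      simp [h5]
  refine ⟨β₂, β₁, fun σ => 2 * b * (R σ + R (-σ) + Q (sPlus a b + σ)), hβ, ⟨?_, ?_⟩, ?_, ?_⟩
  · refine hR.isBigO_one_nhdsNE.congr' ?_ EventuallyEq.rfl
    filter_upwards [h] with σ hσ
    rw [hσ]
    ring
  · refine hRn.isBigO_one_nhdsNE.congr' ?_ EventuallyEq.rfl
    filter_upwards [h'] with σ hσ
    rw [hσ]
    ring
  · exact analyticAt_const.mul ((hR.add hRn).add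
      (AnalyticAt.comp_of_eq hQ (analyticAt_const.add analyticAt_id) (by simp)))
  · filter_upwards [h, h'] with σ h1 h2
    have e : sPlus a b + σ + ((-1 : ℤ) : ℂ) * (charExponent a b : ℂ) = sMinus a b + σ := by
      simp only [sPlus, sMinus]
      push_cast
      ring
    rw [melnikovPotentialC, hQe, Finset.sum_pair (by norm_num), e, h2]
    simp only [Int.cast_zero, zero_mul, add_zero]
    rw [h1]
    ring

theorem exists_melnikovPotentialC_eq_weierstrassP {a b : ℝ} (hb : 0 < b) (hab : b < a) {γ : ℂ}
    {K : ℂ → ℂ} (hK : AnalyticAt ℂ K 0) (h : ∀ᶠ σ in 𝓝[≠] (0 : ℂ),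
      melnikovPotentialC a b (sPlus a b + σ) = γ / σ ^ 2 + K σ) :
    ∃ c : ℂ, ∀ z ∉ melnikovPoles a b, melnikovPotentialC a b z =
      c + γ * (homoclinicPeriods hb hab).weierstrassP (z - sPlus a b) := by
  set Λ := homoclinicPeriods hb hab with hΛ
  set s := sPlus a b with hs
  have htend : Tendsto (fun z : ℂ => z - s) (𝓝[≠] s) (𝓝[≠] 0) := by
    refine tendsto_nhdsWithin_iff.2 ⟨?_, ?_⟩
    · have : Tendsto (fun z : ℂ => z - s) (𝓝 s) (𝓝 (s - s)) := (continuous_sub_right s).tendsto s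
      rw [sub_self] at this
      exact this.mono_left nhdsWithin_le_nhds
    · filter_upwards [self_mem_nhdsWithin] with z hz using sub_ne_zero.2 hz
  obtain ⟨c, hc⟩ := Λ.exists_const_of_analyticAt_off (s := s)
    (F := fun z => melnikovPotentialC a b z - γ * Λ.weierstrassP (z - s))
    -- `weierstrassPExcept 0` is `℘` without its `1 / z²` term, the part left after the double poles
    -- cancel.
    (K := fun z => K (z - s) - γ * Λ.weierstrassPExcept 0 (z - s))
    (fun z hz => (analyticAt_melnikovPotentialC hb hab
      fun hm => hz ((mem_melnikovPoles_iff hb hab).1 hm)).sub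
        (analyticAt_const.mul ((Λ.analyticOnNhd_weierstrassP _ hz).comp_of_eq
          (analyticAt_id.sub analyticAt_const) rfl)))
    (fun z ω hω => by
      rw [melnikovPotentialC_add_lattice hb hab z hω, add_sub_right_comm,
        Λ.weierstrassP_add_coe (z - s) ⟨ω, hω⟩])
    ((AnalyticAt.comp_of_eq hK (analyticAt_id.sub analyticAt_const) (by simp [hs])).sub
      (analyticAt_const.mul (AnalyticAt.comp_of_eq (Λ.analyticAt_weierstrassPExcept 0)
        (analyticAt_id.sub analyticAt_const) (by simp [hs]))))
    (by
      filter_upwards [htend.eventually h] with z hz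
      rw [add_sub_cancel] at hz
      have e := Λ.weierstrassPExcept_add 0 (z - s)
      simp only [ZeroMemClass.coe_zero, sub_zero] at e
      rw [hz, ← e]
      simp
      ring)
  refine ⟨c, fun z hz => ?_⟩
  rw [← hc z fun hm => hz ((mem_melnikovPoles_iff hb hab).2 hm)]
  ring

/-! ### Restriction to the real line, pole orders and the main theorem. -/

theorem ofReal_notMem_melnikovPoles (a b s : ℝ) : (s : ℂ) ∉ melnikovPoles a b := by
  rintro ⟨m, n, h⟩
  have h1 := congrArg Complex.im h
  simp [sPlus] at h1
  have h2 : Real.pi * (1 + 2 * n) = 0 := by linarith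
  have h3 : (1 + 2 * n : ℝ) = 0 := (mul_eq_zero.1 h2).resolve_left Real.pi_ne_zero
  have h4 : 1 + 2 * n = 0 := by exact_mod_cast h3
  omega

theorem muHatC_ofReal (a b s : ℝ) : muHatC a b (s : ℂ) = (muHat a b s : ℂ) := by
  simp [muHatC, muHat]

theorem summable_muHat {a b : ℝ} (hb : 0 < b) (hab : b < a) (s : ℝ) :
    Summable fun j : ℤ => muHat a b (s + j * charExponent a b) := by
  refine Complex.summable_ofReal.1 ((summable_muHatC hb hab (s : ℂ)).congr fun j => ?_)
  rw [← muHatC_ofReal]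
  push_cast
  rfl

theorem melnikovPotentialC_ofReal (a b s : ℝ) :
    melnikovPotentialC a b (s : ℂ) = (melnikovPotential a b s : ℂ) := by
  rw [melnikovPotentialC, melnikovPotential]
  push_cast
  congr 2
  ext j
  rw [← muHatC_ofReal]
  push_cast
  rfl

/-- A punctured neighbourhood of a pole looks like that of `h / 2 + π i / 2`. -/
theorem melnikovPotentialC_add_of_mem {a b : ℝ} (hb : 0 < b) (hab : b < a) {z : ℂ}
    (hz : z ∈ melnikovPoles a b) (σ : ℂ) :
    melnikovPotentialC a b (z + σ) = melnikovPotentialC a b (sPlus a b + σ) := by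
  rw [← melnikovPotentialC_add_lattice hb hab (sPlus a b + σ)
    ((mem_melnikovPoles_iff hb hab).1 hz)]
  congr 1
  ring

theorem meromorphicOrderAt_eq_neg_two_of_laurent {f K : ℂ → ℂ} {z γ : ℂ} (hγ : γ ≠ 0)
    (hK : AnalyticAt ℂ K 0) (h : ∀ᶠ σ in 𝓝[≠] (0 : ℂ), f (z + σ) = γ / σ ^ 2 + K σ) :
    MeromorphicAt f z ∧ meromorphicOrderAt f z = -2 := by
  have htend : Tendsto (fun w : ℂ => w - z) (𝓝[≠] z) (𝓝[≠] 0) := by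
    refine tendsto_nhdsWithin_iff.2 ⟨?_, ?_⟩
    · have : Tendsto (fun w : ℂ => w - z) (𝓝 z) (𝓝 (z - z)) := (continuous_sub_right z).tendsto z
      rw [sub_self] at this
      exact this.mono_left nhdsWithin_le_nhds
    · filter_upwards [self_mem_nhdsWithin] with w hw using sub_ne_zero.2 hw
  have hG : AnalyticAt ℂ (fun w => γ + (w - z) ^ 2 * K (w - z)) z :=
    analyticAt_const.add (((analyticAt_id.sub analyticAt_const).pow 2).mul
      (AnalyticAt.comp_of_eq hK (analyticAt_id.sub analyticAt_const) (by simp)))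
  have hf : ∀ᶠ w in 𝓝[≠] z, f w = (w - z) ^ (-2 : ℤ) • (γ + (w - z) ^ 2 * K (w - z)) := by
    filter_upwards [htend.eventually h, self_mem_nhdsWithin] with w hw hwz
    have hwz' : w - z ≠ 0 := sub_ne_zero.2 hwz
    rw [add_sub_cancel] at hw
    rw [hw, smul_eq_mul, zpow_neg, zpow_ofNat]
    field_simp
  have hm : MeromorphicAt f z := by
    refine MeromorphicAt.congr (f := fun w => (w - z) ^ (-2 : ℤ) • (γ + (w - z) ^ 2 * K (w - z)))
      ?_ (by filter_upwards [hf] with w hw using hw.symm)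
    exact (((analyticAt_id.sub analyticAt_const).meromorphicAt).zpow _).smul hG.meromorphicAt
  exact ⟨hm, (meromorphicOrderAt_eq_int_iff hm).2 ⟨_, hG, by simpa using hγ, hf⟩⟩

/-- The half-open cell contains exactly one representative of `s + Λ`, namely the fractional part of
`s`. -/
theorem ellipticOrder_eq_of_single_pole {Λ : PeriodPair} {f : ℂ → ℂ} {s : ℂ} {n : ℕ}
    (h1 : ∀ z, z - s ∈ Λ.lattice → meromorphicOrderAt f z = (-n : ℤ))
    (h2 : ∀ z, z - s ∉ Λ.lattice → 0 ≤ meromorphicOrderAt f z) : ellipticOrder Λ f = n := by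
  have hsub : ∀ z, z - s ∈ Λ.lattice ↔ z - s ∈ Submodule.span ℤ (Set.range Λ.basis) := fun z => by
    rw [Λ.lattice_eq_span_range_basis]
  set p := ZSpan.fract Λ.basis s with hp
  have hps : p - s ∈ Λ.lattice := by
    rw [hsub, hp, ZSpan.fract_apply, sub_sub_cancel_left]
    exact neg_mem (ZSpan.floor Λ.basis s).2
  have hpF : p ∈ ZSpan.fundamentalDomain Λ.basis := ZSpan.fract_mem_fundamentalDomain _ _
  have huniq : ∀ z ∈ ZSpan.fundamentalDomain Λ.basis, z - s ∈ Λ.lattice → z = p := fun z hz hzs => by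
    rw [← (ZSpan.fract_eq_self (b := Λ.basis)).2 hz, hp, ZSpan.fract_eq_fract,
      neg_add_eq_sub, ← neg_sub]
    exact neg_mem ((hsub z).1 hzs)
  have hzero : ∀ z ∈ ZSpan.fundamentalDomain Λ.basis, z ≠ p →
      (-(meromorphicOrderAt f z).untop₀).toNat = 0 := fun z hz hzp => by
    have h3 := h2 z fun hzs => hzp (huniq z hz hzs)
    have h4 : 0 ≤ (meromorphicOrderAt f z).untop₀ := WithTop.untop₀_nonneg.2 h3
    omega
  rw [ellipticOrder, finsum_eq_single _ p]
  · rw [finsum_eq_single _ hpF (fun h hne => absurd rfl hne), h1 p hps]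
    simp
  · intro z hz
    by_cases hzF : z ∈ ZSpan.fundamentalDomain Λ.basis
    · simp [hzF, hzero z hzF hz]
    · simp [hzF]

/-- The real derivatives of a function with a holomorphic extension. -/
theorem ofReal_deriv_eq_of_ofReal_eq {f : ℝ → ℝ} {F : ℂ → ℂ} (hF : ∀ x : ℝ, F x = (f x : ℂ)) {x : ℝ}
    (hd : DifferentiableAt ℂ F x) : ((deriv f x : ℝ) : ℂ) = deriv F x := by
  have h1 : HasDerivAt f (deriv F x).re x := by
    have := hd.hasDerivAt.real_of_complex
    simpa [hF] using this
  have h2 : HasDerivAt (fun y : ℝ => ((f y : ℝ) : ℂ)) (deriv F x) x := by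
    have := hd.hasDerivAt.comp_ofReal
    simpa [hF] using this
  rw [h1.deriv]
  exact (h1.ofReal_comp).unique h2

theorem mainTheorem3 (a b : ℝ) (hb : 0 < b) (hab : b < a) :
    -- the series converges off the poles, and its complex sum is an analytic extension
    (∀ s : ℝ, Summable fun j : ℤ => muHat a b (s + j * charExponent a b)) ∧
    (∀ z ∉ melnikovPoles a b,
      Summable fun j : ℤ => muHatC a b (z + (j : ℂ) * (charExponent a b : ℂ))) ∧
    (∀ s : ℝ, melnikovPotentialC a b (s : ℂ) = (melnikovPotential a b s : ℂ)) ∧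
    (∀ z ∉ melnikovPoles a b, AnalyticAt ℂ (melnikovPotentialC a b) z) ∧
    -- even elliptic function of order two with periods `h` and `π i`
    Function.Even (melnikovPotentialC a b) ∧
    IsElliptic (homoclinicPeriods hb hab) (melnikovPotentialC a b) ∧
    (∀ ω : ℂ, Function.Periodic (melnikovPotentialC a b) ω →
      ω ∈ (homoclinicPeriods hb hab).lattice) ∧
    ellipticOrder (homoclinicPeriods hb hab) (melnikovPotentialC a b) = 2 ∧
    -- poles and principal parts
    poleSet (melnikovPotentialC a b) = melnikovPoles a b ∧
    (∀ z ∈ melnikovPoles a b, meromorphicOrderAt (melnikovPotentialC a b) z = -2) ∧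
    (∃ β₂ β₁ : ℂ, β₂ ≠ 0 ∧ AreLaurentCoeffs a b β₂ β₁ ∧
      ∀ z ∈ melnikovPoles a b,
        (fun σ : ℂ => melnikovPotentialC a b (z + σ) - 4 * (b : ℂ) * β₂ / σ ^ 2)
          =O[𝓝[≠] 0] fun _ => (1 : ℂ)) ∧
    -- behaviour on the real line
    AnalyticOnNhd ℝ (melnikovPotential a b) Set.univ ∧
    (¬ ∃ C : ℝ, ∀ s : ℝ, melnikovPotential a b s = C) ∧
    (∀ s : ℝ, deriv (melnikovPotential a b) s = 0 ↔
      ∃ n : ℤ, s = n * charExponent a b / 2) ∧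
    (∀ s : ℝ, deriv (melnikovPotential a b) s = 0 →
      deriv (deriv (melnikovPotential a b)) s ≠ 0) := by
  obtain ⟨β₂, β₁, K, hβ, hlc, hK, hloc⟩ := exists_laurent_melnikovPotentialC hb hab
  have hh := charExponent_pos hb hab
  have hγ : 4 * (b : ℂ) * β₂ ≠ 0 :=
    mul_ne_zero (mul_ne_zero (by norm_num) (by exact_mod_cast hb.ne')) hβ
  obtain ⟨c, hc⟩ := exists_melnikovPotentialC_eq_weierstrassP hb hab hK hloc
  have hmem := fun z => mem_melnikovPoles_iff (z := z) hb hab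
  have hana : ∀ z ∉ melnikovPoles a b, AnalyticAt ℂ (melnikovPotentialC a b) z :=
    fun z hz => analyticAt_melnikovPotentialC hb hab hz
  have hpole : ∀ z ∈ melnikovPoles a b, MeromorphicAt (melnikovPotentialC a b) z ∧
      meromorphicOrderAt (melnikovPotentialC a b) z = -2 := fun z hz =>
    meromorphicOrderAt_eq_neg_two_of_laurent hγ hK (by
      filter_upwards [hloc] with σ hσ
      rw [melnikovPotentialC_add_of_mem hb hab hz, hσ])
  have hper : ∀ ω ∈ (homoclinicPeriods hb hab).lattice,
      Function.Periodic (melnikovPotentialC a b) ω :=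
    fun ω hω z => melnikovPotentialC_add_lattice hb hab z hω
  have hneg : (-2 : WithTop ℤ) < 0 := by decide
  have hpoleSet : poleSet (melnikovPotentialC a b) = melnikovPoles a b := by
    ext z
    refine ⟨fun hz => ?_, fun hz => ?_⟩
    · by_contra hzn
      exact absurd (hana z hzn).meromorphicOrderAt_nonneg (not_le.2 hz)
    · change meromorphicOrderAt _ z < 0
      rw [(hpole z hz).2]
      exact hneg
  set Λ := homoclinicPeriods hb hab with hΛ
  set s₀ := sPlus a b with hs₀
  have hopen : IsOpen {z : ℂ | z - s₀ ∉ Λ.lattice} :=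
    Λ.isClosed_lattice.isOpen_compl.preimage (continuous_sub_right s₀)
  have hreal : ∀ s : ℝ, (s : ℂ) - s₀ ∉ Λ.lattice := fun s hs =>
    ofReal_notMem_melnikovPoles a b s ((hmem _).2 hs)
  have hderC : ∀ z, z - s₀ ∉ Λ.lattice → deriv (melnikovPotentialC a b) z =
      4 * b * β₂ * Λ.derivWeierstrassP (z - s₀) := fun z hz => by
    have e : melnikovPotentialC a b =ᶠ[𝓝 z]
        fun w => c + 4 * b * β₂ * Λ.weierstrassP (w - s₀) := by
      filter_upwards [hopen.mem_nhds hz] with w hw using hc w fun hm => hw ((hmem w).1 hm)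
    rw [e.deriv_eq, deriv_const_add, deriv_const_mul_field, deriv_comp_sub_const,
      Λ.deriv_weierstrassP]
  have hder2C : ∀ z, z - s₀ ∉ Λ.lattice → deriv (deriv (melnikovPotentialC a b)) z =
      4 * b * β₂ * deriv Λ.derivWeierstrassP (z - s₀) := fun z hz => by
    have e : deriv (melnikovPotentialC a b) =ᶠ[𝓝 z]
        fun w => 4 * b * β₂ * Λ.derivWeierstrassP (w - s₀) := by
      filter_upwards [hopen.mem_nhds hz] with w hw using hderC w hw
    rw [e.deriv_eq, deriv_const_mul_field, deriv_comp_sub_const]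
  have hder : ∀ s : ℝ, ((deriv (melnikovPotential a b) s : ℝ) : ℂ) = deriv (melnikovPotentialC a b) s :=
    fun s => ofReal_deriv_eq_of_ofReal_eq (melnikovPotentialC_ofReal a b)
      (hana s (ofReal_notMem_melnikovPoles a b s)).differentiableAt
  have hder2 : ∀ s : ℝ, ((deriv (deriv (melnikovPotential a b)) s : ℝ) : ℂ) =
      deriv (deriv (melnikovPotentialC a b)) s :=
    fun s => ofReal_deriv_eq_of_ofReal_eq (fun x => (hder x).symm)
      (hana s (ofReal_notMem_melnikovPoles a b s)).deriv.differentiableAt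
  have hzero : ∀ s : ℝ, deriv (melnikovPotential a b) s = 0 ↔
      Λ.derivWeierstrassP (s - s₀) = 0 := fun s => by
    rw [← Complex.ofReal_eq_zero, hder, hderC _ (hreal s), mul_eq_zero, or_iff_right hγ]
  have hcrit : ∀ s : ℝ, deriv (melnikovPotential a b) s = 0 ↔
      ∃ n : ℤ, s = n * charExponent a b / 2 := fun s => by
    rw [hzero, Λ.derivWeierstrassP_eq_zero_iff (hreal s), PeriodPair.mem_lattice]
    constructor
    · rintro ⟨m, n, h⟩
      refine ⟨m + 1, ?_⟩
      have h1 := congrArg Complex.re h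
      simp [hΛ, homoclinicPeriods, hs₀, sPlus] at h1
      push_cast
      linarith
    · rintro ⟨n, rfl⟩
      -- Here `2 (s - s₀) = 2 s - h - π i`, which accounts for both shifts by one.
      refine ⟨n - 1, -1, ?_⟩
      simp only [hΛ, homoclinicPeriods, hs₀, sPlus]
      push_cast
      ring
  refine ⟨summable_muHat hb hab, fun z _ => summable_muHatC hb hab z,
    melnikovPotentialC_ofReal a b, hana, melnikovPotentialC_neg a b, ⟨fun z => ?_, hper⟩,
    fun ω hω => ?_, ?_, hpoleSet, fun z hz => (hpole z hz).2, ⟨β₂, β₁, hβ, hlc, fun z hz => ?_⟩,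
    fun s _ => ?_, ?_, hcrit, fun s hs h2 => ?_⟩
  · by_cases hz : z ∈ melnikovPoles a b
    · exact (hpole z hz).1
    · exact (hana z hz).meromorphicAt
  -- A period carries the pole `s₀` to a pole, and all poles lie in `s₀ + Λ`.
  · have h1 : s₀ ∈ melnikovPoles a b := (hmem s₀).2 (by rw [sub_self]; exact zero_mem _)
    have h2 : s₀ + ω ∈ poleSet (melnikovPotentialC a b) := by
      change meromorphicOrderAt _ _ < 0
      have h3 := meromorphicOrderAt_comp_add_const_eq_meromorphicOrderAt
        (f := melnikovPotentialC a b) (x := s₀) (c := ω)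
      rw [show melnikovPotentialC a b ∘ (fun x => x + ω) = melnikovPotentialC a b from funext hω]
        at h3
      rw [← h3, (hpole s₀ h1).2]
      exact hneg
    rw [hpoleSet, hmem, add_sub_cancel_left] at h2
    exact h2
  · exact ellipticOrder_eq_of_single_pole (s := s₀) (fun z hz => (hpole z ((hmem z).2 hz)).2)
      fun z hz => (hana z fun hm => hz ((hmem z).1 hm)).meromorphicOrderAt_nonneg
  · refine hK.isBigO_one_nhdsNE.congr' ?_ EventuallyEq.rfl
    filter_upwards [hloc] with σ hσ
    rw [melnikovPotentialC_add_of_mem hb hab hz, hσ]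
    ring
  · have h1 := (hana s (ofReal_notMem_melnikovPoles a b s)).re_ofReal
    simpa [melnikovPotentialC_ofReal] using h1
  · rintro ⟨C, hC⟩
    -- A constant would be critical at `h / 4`, which is not a multiple of `h / 2`.
    have h1 : deriv (melnikovPotential a b) (charExponent a b / 4) = 0 := by
      rw [funext hC, deriv_const]
    obtain ⟨n, hn⟩ := (hcrit _).1 h1
    have h2 : charExponent a b * (1 - 2 * n) = 0 := by linarith
    have h3 : (1 - 2 * n : ℝ) = 0 := (mul_eq_zero.1 h2).resolve_left hh.ne'
    have h4 : 1 - 2 * n = 0 := by exact_mod_cast h3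
    omega
  · refine Λ.deriv_derivWeierstrassP_ne_zero (hreal s) ((hzero s).1 hs) ?_
    have h3 := hder2 s
    rw [h2, hder2C _ (hreal s), Complex.ofReal_zero] at h3
    exact (mul_eq_zero.1 h3.symm).resolve_left hγ
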